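/- Let $U\subset\mathbb C$ be an open set conformally equivalent to the open unit disc $\mathbb D$, let $W$ be a complex Banach space, and let $\mathscr F$ be an admissible space of analytic functions $U\to W$: a Banach space of analytic functions $F:U\to W$ such that (a) for every $z\in U$ the evaluation map $\delta_z:\mathscr F\to W$, $F\mapsto F(z)$, is bounded, and (b) for every conformal equivalence $\varphi:U\to\mathbb D$ and every analytic $F:U\to W$ one has $F\in\mathscr F$ if and only if $\varphi\cdot F\in\mathscr F$, and in that case $\|\varphi\cdot F\|_{\mathscr F}=\|F\|_{\mathscr F}$. Fix $z\in U$. For $n\ge 1$ let $$\mathscr Z^{(n)}=\{(x_{n-1},\dots,x_0)\in W^n:\ \text{there is } f\in\mathscr F \text{ with } x_i=f^{(i)}(z)/i!\ \text{ for all } 0\le i<n\},$$ endowed with the norm $\|x\|=\inf\|f\|_{\mathscr F}$, where the infimum is taken over all such $f$. For $1\le k<n$ let $\mathscr Z^{(k)}\to\mathscr Z^{(n)}$ be the bounded operator $(x_{k-1},\dots,x_0)\mapsto(x_{k-1},\dots,x_0,0,\dots,0)$, called the inclusion. A bounded operator $u:A\to B$ between Banach spaces is strictly cosingular if, for every closed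 subspace $C$ of $B$ of infinite codimension, the composition $A\xrightarrow{u}B\to B/C$ fails to be onto. If the inclusion $\mathscr Z^{(1)}\to\mathscr Z^{(2)}$ is strictly cosingular, then the inclusion $\mathscr Z^{(k)}\to\mathscr Z^{(n)}$ is strictly cosingular for all integers $1\le k<n$. -/

import Mathlib

open Set Filter Topology

/-- A conformal equivalence from `U ⊆ ℂ` onto the open unit disc: a holomorphic bijection with
holomorphic inverse.  Only the values of `φ` on `U` matter. -/
def IsConformalEquivDisc (U : Set ℂ) (φ : ℂ → ℂ) : Prop :=
  DifferentiableOn ℂ φ U ∧ BijOn φ U (Metric.ball 0 1) ∧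
    ∃ ψ : ℂ → ℂ, DifferentiableOn ℂ ψ (Metric.ball 0 1) ∧ InvOn ψ φ U (Metric.ball 0 1)

/-- An admissible space of analytic functions `U → W`.

The elements of the Banach space `𝓕` are analytic functions on `U` with values in `W`: `toFun`
realizes them as functions, linearly, and two elements with the same values on `U` are equal.
Functions are written as maps `ℂ → W`, but only their values on `U` matter. -/
structure AdmissibleSpace (U : Set ℂ) (W 𝓕 : Type*)
    [NormedAddCommGroup W] [NormedSpace ℂ W] [CompleteSpace W]
    [NormedAddCommGroup 𝓕] [NormedSpace ℂ 𝓕] [CompleteSpace 𝓕] where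
  isOpen : IsOpen U
  exists_conformal : ∃ φ : ℂ → ℂ, IsConformalEquivDisc U φ
  toFun : 𝓕 →ₗ[ℂ] (ℂ → W)
  ext_on : ∀ f g : 𝓕, EqOn (toFun f) (toFun g) U → f = g
  analytic : ∀ f : 𝓕, DifferentiableOn ℂ (toFun f) U
  /-- (a) the evaluation maps are bounded -/
  eval_bounded : ∀ z ∈ U, ∃ C : ℝ, ∀ f : 𝓕, ‖toFun f z‖ ≤ C * ‖f‖
  /-- (b) an analytic function `G : U → W` belongs to the space if and only if `φ · G` does,
  for every conformal equivalence `φ` of `U` onto the disc -/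
  mul_mem_iff : ∀ φ : ℂ → ℂ, IsConformalEquivDisc U φ →
    ∀ G : ℂ → W, DifferentiableOn ℂ G U →
      ((∃ f : 𝓕, EqOn (toFun f) G U) ↔ ∃ f : 𝓕, EqOn (toFun f) (fun w => φ w • G w) U)
  /-- (b) multiplication by `φ` preserves the norm -/
  norm_mul : ∀ φ : ℂ → ℂ, IsConformalEquivDisc U φ →
    ∀ f g : 𝓕, EqOn (toFun g) (fun w => φ w • toFun f w) U → ‖g‖ = ‖f‖

/-- The `i`-th Taylor coefficient `F⁽ⁱ⁾(z) / i!` of `F` at `z`. -/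
noncomputable def taylorCoeff {W : Type*} [NormedAddCommGroup W] [NormedSpace ℂ W]
    (F : ℂ → W) (i : ℕ) (z : ℂ) : W :=
  ((i.factorial : ℂ))⁻¹ • iteratedDeriv i F z

section TaylorFacts

variable {W : Type*} [NormedAddCommGroup W] [NormedSpace ℂ W] {U : Set ℂ} {z : ℂ}

theorem taylorCoeff_congr (hU : IsOpen U) (hz : z ∈ U) {F G : ℂ → W} (h : EqOn F G U) (i : ℕ) :
    taylorCoeff F i z = taylorCoeff G i z := by
  unfold taylorCoeff
  rw [h.iteratedDeriv_of_isOpen hU i hz]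

theorem taylorCoeff_sub_smul_zero (F : ℂ → W) :
    taylorCoeff (fun w => (w - z) • F w) 0 z = 0 := by
  simp [taylorCoeff]

theorem taylorCoeff_smul (c : ℂ) (F : ℂ → W) (i : ℕ) :
    taylorCoeff (c • F) i z = c • taylorCoeff F i z := by
  unfold taylorCoeff
  rw [iteratedDeriv_const_smul_field, smul_comm]

variable [CompleteSpace W]

theorem differentiableOn_contDiffAt (hU : IsOpen U) (hz : z ∈ U) {F : ℂ → W}
    (hF : DifferentiableOn ℂ F U) (n : WithTop ℕ∞) : ContDiffAt ℂ n F z :=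
  (hF.contDiffOn hU).contDiffAt (hU.mem_nhds hz)

theorem differentiableOn_iteratedDeriv (hU : IsOpen U) {F : ℂ → W}
    (hF : DifferentiableOn ℂ F U) (i : ℕ) : DifferentiableOn ℂ (iteratedDeriv i F) U := by
  induction i with
  | zero => simpa using hF
  | succ i ih => rw [iteratedDeriv_succ]; exact ih.deriv hU

theorem taylorCoeff_add (hU : IsOpen U) (hz : z ∈ U) {F G : ℂ → W}
    (hF : DifferentiableOn ℂ F U) (hG : DifferentiableOn ℂ G U) (i : ℕ) :
    taylorCoeff (F + G) i z = taylorCoeff F i z + taylorCoeff G i z := by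
  unfold taylorCoeff
  rw [iteratedDeriv_add (differentiableOn_contDiffAt hU hz hF _)
    (differentiableOn_contDiffAt hU hz hG _), smul_add]

theorem iteratedDeriv_sub_smul (hU : IsOpen U) {F : ℂ → W}
    (hF : DifferentiableOn ℂ F U) (i : ℕ) :
    EqOn (iteratedDeriv (i + 1) (fun w => (w - z) • F w))
      (fun w => (w - z) • iteratedDeriv (i + 1) F w + ((i : ℂ) + 1) • iteratedDeriv i F w) U := by
  have key : ∀ (G : ℂ → W), DifferentiableOn ℂ G U → ∀ w ∈ U,
      HasDerivAt (fun w => (w - z) • G w) ((w - z) • deriv G w + (1 : ℂ) • G w) w := by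
    intro G hG w hw
    exact ((hasDerivAt_id w).sub_const z).smul
      ((hG w hw).differentiableAt (hU.mem_nhds hw)).hasDerivAt
  induction i with
  | zero =>
    intro w hw
    simp [iteratedDeriv_one, (key F hF w hw).deriv]
  | succ i ih =>
    intro w hw
    rw [iteratedDeriv_succ]
    have h1 : iteratedDeriv (i + 1) (fun w => (w - z) • F w) =ᶠ[𝓝 w]
        (fun w => (w - z) • iteratedDeriv (i + 1) F w + ((i : ℂ) + 1) • iteratedDeriv i F w) :=
      ih.eventuallyEq_of_mem (hU.mem_nhds hw)
    rw [h1.deriv_eq]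
    have h2 := key _ (differentiableOn_iteratedDeriv hU hF (i + 1)) w hw
    have h3 := (((differentiableOn_iteratedDeriv hU hF i) w hw).differentiableAt
      (hU.mem_nhds hw)).hasDerivAt.const_smul ((i : ℂ) + 1)
    rw [← iteratedDeriv_succ] at h2 h3
    refine (h2.add h3).deriv.trans ?_
    push_cast
    module

theorem taylorCoeff_sub_smul_succ (hU : IsOpen U) (hz : z ∈ U) {F : ℂ → W}
    (hF : DifferentiableOn ℂ F U) (i : ℕ) :
    taylorCoeff (fun w => (w - z) • F w) (i + 1) z = taylorCoeff F i z := by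
  unfold taylorCoeff
  rw [iteratedDeriv_sub_smul hU hF i hz]
  have h : ((i : ℂ) + 1) ≠ 0 := by exact_mod_cast Nat.succ_ne_zero i
  simp only [sub_self, zero_smul, zero_add, smul_smul, Nat.factorial_succ]
  congr 1
  push_cast
  field_simp

theorem taylorCoeff_sub_pow_smul (hU : IsOpen U) (hz : z ∈ U) (m : ℕ) :
    ∀ {F : ℂ → W}, DifferentiableOn ℂ F U → ∀ i < m,
      taylorCoeff (fun w => (w - z) ^ m • F w) i z = 0 := by
  induction m with
  | zero => intro F _ i hi; omega
  | succ m ih =>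
    intro F hF i hi
    have e : (fun w => (w - z) ^ (m + 1) • F w) =
        fun w => (w - z) • ((fun w => (w - z) ^ m • F w) w) := by
      funext w; rw [smul_smul, pow_succ']
    have hG : DifferentiableOn ℂ (fun w => (w - z) ^ m • F w) U :=
      DifferentiableOn.smul (by fun_prop) hF
    rw [e]
    cases i with
    | zero => exact taylorCoeff_sub_smul_zero _
    | succ i => rw [taylorCoeff_sub_smul_succ hU hz hG]; exact ih hF i (by omega)

end TaylorFacts

namespace AdmissibleSpace

variable {U : Set ℂ} {W 𝓕 : Type*}
  [NormedAddCommGroup W] [NormedSpace ℂ W] [CompleteSpace W]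
  [NormedAddCommGroup 𝓕] [NormedSpace ℂ 𝓕] [CompleteSpace 𝓕]

/-- The list `(f̂[n-1; z], …, f̂[0; z])` of the first `n` Taylor coefficients of `f` at `z`,
in decreasing order. -/
noncomputable def taylorList (A : AdmissibleSpace U W 𝓕) (z : U) (n : ℕ) :
    𝓕 →ₗ[ℂ] (Fin n → W) where
  toFun f := fun j => taylorCoeff (A.toFun f) (n - 1 - (j : ℕ)) z
  map_add' f g := by
    funext j
    rw [map_add]
    exact taylorCoeff_add A.isOpen z.2 (A.analytic f) (A.analytic g) _
  map_smul' c f := by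
    funext j
    rw [map_smul]
    exact taylorCoeff_smul c _ _

theorem iteratedDeriv_continuous (A : AdmissibleSpace U W 𝓕) (i : ℕ) :
    ∀ z ∈ U, Continuous fun f : 𝓕 => iteratedDeriv i (A.toFun f) z := by
  have lin : ∀ (i : ℕ), ∀ z ∈ U, ∃ L : 𝓕 →ₗ[ℂ] W, ∀ f, L f = iteratedDeriv i (A.toFun f) z := by
    intro i z hz
    refine ⟨{ toFun := fun f => iteratedDeriv i (A.toFun f) z, map_add' := ?_, map_smul' := ?_ },
      fun f => rfl⟩
    · intro f g
      rw [map_add, iteratedDeriv_add (differentiableOn_contDiffAt A.isOpen hz (A.analytic f) _)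
        (differentiableOn_contDiffAt A.isOpen hz (A.analytic g) _)]
    · intro c f
      rw [map_smul, iteratedDeriv_const_smul_field]
      rfl
  induction i with
  | zero =>
    intro z hz
    obtain ⟨L, hL⟩ := lin 0 z hz
    obtain ⟨C, hC⟩ := A.eval_bounded z hz
    have : Continuous L := by
      refine (L.mkContinuous C fun f => ?_).continuous
      rw [hL, iteratedDeriv_zero]
      exact hC f
    simpa only [← hL] using this
  | succ i ih =>
    intro z hz
    choose! L hL using lin i
    have hLc : ∀ w ∈ U, Continuous (L w) := by
      intro w hw
      have h : (L w : 𝓕 → W) = fun f : 𝓕 => iteratedDeriv i (A.toFun f) w := funext (hL w hw)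
      rw [h]
      exact ih w hw
    have hex : ∀ w, ∃ T : 𝓕 →L[ℂ] W,
        w ∈ U → ∀ f, T f = (w - z)⁻¹ • (L w f - L z f) := by
      intro w
      by_cases hw : w ∈ U
      · exact ⟨(w - z)⁻¹ • ((⟨L w, hLc w hw⟩ : 𝓕 →L[ℂ] W) - ⟨L z, hLc z hz⟩),
          fun _ f => rfl⟩
      · exact ⟨0, fun h => absurd h hw⟩
    choose T hT using hex
    have hlim : Tendsto (fun w f => T w f) (𝓝[≠] z)
        (𝓝 fun f : 𝓕 => iteratedDeriv (i + 1) (A.toFun f) z) := by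
      rw [tendsto_pi_nhds]
      intro f
      have hd := (((differentiableOn_iteratedDeriv A.isOpen (A.analytic f) i) z hz).differentiableAt
        (A.isOpen.mem_nhds hz)).hasDerivAt
      rw [← iteratedDeriv_succ, hasDerivAt_iff_tendsto_slope] at hd
      refine hd.congr' ?_
      filter_upwards [mem_nhdsWithin_of_mem_nhds (A.isOpen.mem_nhds hz)] with w hw
      rw [hT w hw, hL w hw, hL z hz, slope_def_module]
    exact (continuousLinearMapOfTendsto T hlim).continuous

theorem taylorList_continuous (A : AdmissibleSpace U W 𝓕) (z : U) (n : ℕ) :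
    Continuous (A.taylorList z n) := by
  refine continuous_pi fun j => ?_
  exact (A.iteratedDeriv_continuous _ z z.2).const_smul _

/-- The space `𝓩⁽ⁿ⁾` at the base point `z`: the lists `(x_{n-1}, …, x_0) ∈ Wⁿ` of Taylor
coefficients at `z` of functions in the admissible space.  (As a type of its own, because it does
not carry the norm of `Wⁿ`.) -/
def Derived (A : AdmissibleSpace U W 𝓕) (z : U) (n : ℕ) : Type _ :=
  LinearMap.range (A.taylorList z n)

namespace Derived

variable {A : AdmissibleSpace U W 𝓕} {z : U} {n : ℕ}

/-- The underlying list in `Wⁿ`. -/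
def list (x : A.Derived z n) : Fin n → W := Subtype.val x

noncomputable instance : AddCommGroup (A.Derived z n) :=
  inferInstanceAs (AddCommGroup (LinearMap.range (A.taylorList z n)))

noncomputable instance : Module ℂ (A.Derived z n) :=
  inferInstanceAs (Module ℂ (LinearMap.range (A.taylorList z n)))

/-- The identification of `𝓩⁽ⁿ⁾` with the quotient of the admissible space by
the functions whose first `n` Taylor coefficients (derivatives) at `z` vanish. -/
noncomputable def toQuotient (A : AdmissibleSpace U W 𝓕) (z : U) (n : ℕ) :
    A.Derived z n ≃ₗ[ℂ] 𝓕 ⧸ LinearMap.ker (A.taylorList z n) :=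
  (A.taylorList z n).quotKerEquivRange.symm

instance isClosed_ker :
    IsClosed ((LinearMap.ker (A.taylorList z n) : Submodule ℂ 𝓕) : Set 𝓕) :=
  isClosed_singleton.preimage (A.taylorList_continuous z n)

/-- `𝓩⁽ⁿ⁾` carries the quotient norm. -/
noncomputable instance : NormedAddCommGroup (A.Derived z n) :=
  NormedAddCommGroup.induced _ _ (toQuotient A z n) (toQuotient A z n).injective

noncomputable instance : NormedSpace ℂ (A.Derived z n) :=
  NormedSpace.induced ℂ _ _ (toQuotient A z n)

/-- The element of `𝓩⁽ⁿ⁾` given by a function. -/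
noncomputable def mk (A : AdmissibleSpace U W 𝓕) (z : U) (n : ℕ) (f : 𝓕) : A.Derived z n :=
  ⟨A.taylorList z n f, f, rfl⟩

theorem toQuotient_mk (f : 𝓕) :
    toQuotient A z n (mk A z n f) = Submodule.Quotient.mk f := by
  exact ((A.taylorList z n).quotKerEquivRange.symm_apply_eq (x := ⟨A.taylorList z n f, f, rfl⟩)).2 rfl

theorem norm_mk_le (f : 𝓕) : ‖mk A z n f‖ ≤ ‖f‖ := by
  change ‖toQuotient A z n (mk A z n f)‖ ≤ _
  rw [toQuotient_mk]
  exact Submodule.Quotient.norm_mk_le _ f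

theorem exists_norm_lt (x : A.Derived z n) {ε : ℝ} (hε : 0 < ε) :
    ∃ f : 𝓕, mk A z n f = x ∧ ‖f‖ < ‖x‖ + ε := by
  obtain ⟨f, hf, hlt⟩ := Submodule.Quotient.norm_mk_lt (toQuotient A z n x) hε
  exact ⟨f, (toQuotient A z n).injective (by rw [toQuotient_mk, hf]), hlt⟩

/-- The norm of `𝓩⁽ⁿ⁾` is `‖x‖ = inf {‖f‖ : x is the list of Taylor coefficients of f}`. -/
theorem norm_isGLB (x : A.Derived z n) :
    IsGLB {r : ℝ | ∃ f : 𝓕, A.taylorList z n f = x.list ∧ ‖f‖ = r} ‖x‖ := by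
  constructor
  · rintro r ⟨f, hf, rfl⟩
    have : mk A z n f = x := Subtype.ext hf
    rw [← this]
    exact norm_mk_le f
  · intro b hb
    refine le_of_forall_pos_le_add fun ε hε => ?_
    obtain ⟨f, rfl, hlt⟩ := exists_norm_lt x hε
    exact (hb ⟨f, rfl, rfl⟩).trans hlt.le

end Derived

/-- `ψ` is a multiplier: multiplication by `ψ` is a bounded operator of the admissible space. -/
def IsMultiplier (A : AdmissibleSpace U W 𝓕) (ψ : ℂ → ℂ) : Prop :=
  ∃ T : 𝓕 →L[ℂ] 𝓕, ∀ f, ∀ w ∈ U, A.toFun (T f) w = ψ w • A.toFun f w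

theorem IsMultiplier.add {A : AdmissibleSpace U W 𝓕} {ψ χ : ℂ → ℂ} (h : A.IsMultiplier ψ)
    (h' : A.IsMultiplier χ) : A.IsMultiplier (fun w => ψ w + χ w) := by
  obtain ⟨T, hT⟩ := h
  obtain ⟨S, hS⟩ := h'
  exact ⟨T + S, fun f w hw => by simp [hT f w hw, hS f w hw, add_smul]⟩

theorem IsMultiplier.mul {A : AdmissibleSpace U W 𝓕} {ψ χ : ℂ → ℂ} (h : A.IsMultiplier ψ)
    (h' : A.IsMultiplier χ) : A.IsMultiplier (fun w => ψ w * χ w) := by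
  obtain ⟨T, hT⟩ := h
  obtain ⟨S, hS⟩ := h'
  exact ⟨T.comp S, fun f w hw => by simp [hT _ w hw, hS f w hw, mul_smul]⟩

theorem IsMultiplier.const (A : AdmissibleSpace U W 𝓕) (c : ℂ) :
    A.IsMultiplier (fun _ => c) :=
  ⟨c • ContinuousLinearMap.id ℂ 𝓕, fun f w _ => by simp⟩

theorem IsMultiplier.pow {A : AdmissibleSpace U W 𝓕} {ψ : ℂ → ℂ} (h : A.IsMultiplier ψ)
    (n : ℕ) : A.IsMultiplier (fun w => ψ w ^ n) := by
  induction n with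
  | zero => simpa using IsMultiplier.const A 1
  | succ n ih => simpa only [pow_succ] using ih.mul h

theorem IsMultiplier.conformal (A : AdmissibleSpace U W 𝓕) {φ : ℂ → ℂ}
    (hφ : IsConformalEquivDisc U φ) : A.IsMultiplier φ := by
  have h : ∀ f : 𝓕, ∃ g : 𝓕, EqOn (A.toFun g) (fun w => φ w • A.toFun f w) U := fun f =>
    (A.mul_mem_iff φ hφ (A.toFun f) (A.analytic f)).1 ⟨f, fun _ _ => rfl⟩
  choose T hT using h
  let L : 𝓕 →ₗ[ℂ] 𝓕 :=
    { toFun := T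
      map_add' := fun f g => A.ext_on _ _ fun w hw => by
        simp [hT (f + g) hw, hT f hw, hT g hw]
      map_smul' := fun c f => A.ext_on _ _ fun w hw => by
        simp [hT (c • f) hw, hT f hw, smul_comm c] }
  refine ⟨L.mkContinuous 1 fun f => ?_, fun f w hw => hT f hw⟩
  rw [one_mul]
  exact (A.norm_mul φ hφ f (T f) (hT f)).le

theorem exists_multiplier_contact (A : AdmissibleSpace U W 𝓕) (z : U) (m : ℕ) :
    ∃ ψ : ℂ → ℂ, A.IsMultiplier ψ ∧ ∃ r : ℂ → ℂ, DifferentiableOn ℂ r U ∧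
      ∀ w ∈ U, ψ w = (w - z) + (w - z) ^ (m + 1) * r w := by
  obtain ⟨φ, hφ⟩ := A.exists_conformal
  have hU := A.isOpen.mem_nhds z.2
  have hdφ : DifferentiableAt ℂ φ z := (hφ.1 z z.2).differentiableAt hU
  have hφ' : deriv φ z ≠ 0 := by
    obtain ⟨hd, hb, θ, hθ, hinv⟩ := hφ
    have h1 := ((hθ (φ z) (hb.mapsTo z.2)).differentiableAt
      (Metric.isOpen_ball.mem_nhds (hb.mapsTo z.2))).hasDerivAt.comp (z : ℂ) hdφ.hasDerivAt
    have h2 : θ ∘ φ =ᶠ[𝓝 (z : ℂ)] id :=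
      (show EqOn (θ ∘ φ) id U from fun w hw => hinv.1 hw).eventuallyEq_of_mem hU
    have h3 := h1.unique ((hasDerivAt_id (z : ℂ)).congr_of_eventuallyEq h2)
    intro h0
    rw [h0, mul_zero] at h3
    exact zero_ne_one h3
  set h : ℂ → ℂ := dslope φ z with hh
  have hhd : DifferentiableOn ℂ h U := (Complex.differentiableOn_dslope hU).2 hφ.1
  have hhz : h z = deriv φ z := dslope_same _ _
  have hfac : ∀ w, φ w - φ z = (w - z) * h w := fun w => by
    simpa using (sub_smul_dslope φ (z : ℂ) w).symm
  have hmult : A.IsMultiplier (fun w => φ w - φ z) := by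
    simpa only [sub_eq_add_neg] using
      (IsMultiplier.conformal A hφ).add (IsMultiplier.const A (-φ z))
  induction m with
  | zero =>
    refine ⟨fun _ => 0, IsMultiplier.const A 0, fun _ => -1, by fun_prop, fun w _ => by ring⟩
  | succ m ih =>
    obtain ⟨ψ, hψ, r, hr, hψr⟩ := ih
    set c : ℂ := (deriv φ z)⁻¹ with hc
    set s : ℂ → ℂ := fun w => r w - r z * (c * h w) ^ (m + 1) with hs
    have hsd : DifferentiableOn ℂ s U :=
      hr.sub ((hhd.const_mul c).pow (m + 1) |>.const_mul (r z))
    have hsz : s z = 0 := by simp [hs, hhz, hc, inv_mul_cancel₀ hφ']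
    refine ⟨fun w => ψ w + (-(r z * c ^ (m + 1))) * (φ w - φ z) ^ (m + 1),
      hψ.add ((IsMultiplier.const A _).mul (hmult.pow (m + 1))), dslope s z,
      (Complex.differentiableOn_dslope hU).2 hsd, fun w hw => ?_⟩
    have e : s w = (w - z) * dslope s z w := by
      simpa [hsz] using (sub_smul_dslope s (z : ℂ) w).symm
    have e' : (w - (z : ℂ)) ^ (m + 1 + 1) * dslope s z w = (w - z) ^ (m + 1) * s w := by
      rw [e]; ring
    have hsw : s w = r w - r z * (c * h w) ^ (m + 1) := rfl
    beta_reduce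
    rw [e', hψr w hw, hfac w, hsw, mul_pow (w - (z : ℂ)), mul_pow c]
    ring

/-- A bounded operator of the admissible space that shifts the first `m` Taylor coefficients
at `z` by `k` places. -/
theorem exists_shift (A : AdmissibleSpace U W 𝓕) (z : U) (m k : ℕ) :
    ∃ T : 𝓕 →L[ℂ] 𝓕, ∀ f, ∀ i < m, taylorCoeff (A.toFun (T f)) i z =
      if k ≤ i then taylorCoeff (A.toFun f) (i - k) z else 0 := by
  obtain ⟨ψ, ⟨S, hS⟩, r, hr, hψ⟩ := A.exists_multiplier_contact z m
  have hS1 : ∀ f, ∀ i < m, taylorCoeff (A.toFun (S f)) i z =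
      if 1 ≤ i then taylorCoeff (A.toFun f) (i - 1) z else 0 := by
    intro f i hi
    have hf := A.analytic f
    have h1 : DifferentiableOn ℂ (fun w => (w - (z : ℂ)) • A.toFun f w) U :=
      DifferentiableOn.smul (by fun_prop) hf
    have h2 : DifferentiableOn ℂ (fun w => r w • A.toFun f w) U := hr.smul hf
    have h3 : DifferentiableOn ℂ (fun w => (w - (z : ℂ)) ^ (m + 1) • (r w • A.toFun f w)) U :=
      DifferentiableOn.smul (by fun_prop) h2
    have e : EqOn (A.toFun (S f)) ((fun w => (w - (z : ℂ)) • A.toFun f w) +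
        fun w => (w - (z : ℂ)) ^ (m + 1) • (r w • A.toFun f w)) U := by
      intro w hw
      simp only [Pi.add_apply]
      rw [hS f w hw, hψ w hw, add_smul, mul_smul]
    rw [taylorCoeff_congr A.isOpen z.2 e, taylorCoeff_add A.isOpen z.2 h1 h3,
      taylorCoeff_sub_pow_smul A.isOpen z.2 (m + 1) h2 i (by omega), add_zero]
    cases i with
    | zero => simpa using taylorCoeff_sub_smul_zero (z := (z : ℂ)) (A.toFun f)
    | succ i => simpa using taylorCoeff_sub_smul_succ A.isOpen z.2 hf i
  induction k with
  | zero => exact ⟨ContinuousLinearMap.id ℂ 𝓕, fun f i _ => by simp⟩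
  | succ k ih =>
    obtain ⟨T, hT⟩ := ih
    refine ⟨S.comp T, fun f i hi => ?_⟩
    rw [ContinuousLinearMap.comp_apply, hS1 _ i hi]
    by_cases h1 : 1 ≤ i
    · rw [if_pos h1, hT f (i - 1) (by omega)]
      by_cases h2 : k + 1 ≤ i
      · rw [if_pos h2, if_pos (by omega), show i - 1 - k = i - (k + 1) by omega]
      · rw [if_neg h2, if_neg (by omega)]
    · rw [if_neg h1, if_neg (by omega)]

/-- The inclusion on the left `Wⁿ → Wᵐ`, `(x_n, …, x_1) ↦ (x_n, …, x_1, 0, …, 0)`. -/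
def padRight (W : Type*) [NormedAddCommGroup W] [NormedSpace ℂ W] (n m : ℕ) :
    (Fin n → W) →ₗ[ℂ] (Fin m → W) where
  toFun x := fun j => if h : (j : ℕ) < n then x ⟨j, h⟩ else 0
  map_add' x y := by
    funext j
    by_cases h : (j : ℕ) < n <;> simp [h]
  map_smul' c x := by
    funext j
    by_cases h : (j : ℕ) < n <;> simp [h]

theorem exists_pad (A : AdmissibleSpace U W 𝓕) (z : U) {n m : ℕ} (hnm : n ≤ m) :
    ∃ T : 𝓕 →L[ℂ] 𝓕, ∀ f, A.taylorList z m (T f) = padRight W n m (A.taylorList z n f) := by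
  obtain ⟨T, hT⟩ := A.exists_shift z m (m - n)
  refine ⟨T, fun f => ?_⟩
  funext j
  have hj := j.2
  change taylorCoeff (A.toFun (T f)) (m - 1 - (j : ℕ)) z =
    if h : (j : ℕ) < n then taylorCoeff (A.toFun f) (n - 1 - (j : ℕ)) z else 0
  rw [hT f _ (by omega)]
  by_cases h : (j : ℕ) < n
  · rw [dif_pos h, if_pos (by omega)]
    congr 1
    omega
  · rw [dif_neg h, if_neg (by omega)]

theorem padRight_mem (A : AdmissibleSpace U W 𝓕) (z : U) {n m : ℕ} (hnm : n ≤ m)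
    (x : A.Derived z n) : padRight W n m x.list ∈ LinearMap.range (A.taylorList z m) := by
  obtain ⟨T, hT⟩ := A.exists_pad z hnm
  obtain ⟨f, hf⟩ := x.2
  exact ⟨T f, by rw [hT f, hf]; rfl⟩

/-- The inclusion `𝓩⁽ⁿ⁾ → 𝓩⁽ᵐ⁾`, `(x_n, …, x_1) ↦ (x_n, …, x_1, 0, …, 0)`, for `n ≤ m`,
as a bounded operator. -/
noncomputable def incl (A : AdmissibleSpace U W 𝓕) (z : U) {n m : ℕ} (hnm : n ≤ m) :
    A.Derived z n →L[ℂ] A.Derived z m where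
  toFun x := ⟨padRight W n m x.list, A.padRight_mem z hnm x⟩
  map_add' x y := Subtype.ext (map_add (padRight W n m) x.list y.list)
  map_smul' c x := Subtype.ext (map_smul (padRight W n m) c x.list)
  cont := by
    obtain ⟨T, hT⟩ := A.exists_pad z hnm
    let L : A.Derived z n →ₗ[ℂ] A.Derived z m :=
      { toFun := fun x => ⟨padRight W n m x.list, A.padRight_mem z hnm x⟩
        map_add' := fun x y => Subtype.ext (map_add (padRight W n m) x.list y.list)
        map_smul' := fun c x => Subtype.ext (map_smul (padRight W n m) c x.list) }
    refine (L.mkContinuous ‖T‖ fun x => le_of_forall_pos_le_add fun ε hε => ?_).continuous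
    have hδ : 0 < ε / (‖T‖ + 1) := by positivity
    obtain ⟨f, hf, hlt⟩ := Derived.exists_norm_lt x hδ
    have e : L x = Derived.mk A z m (T f) := by
      subst hf
      exact Subtype.ext (hT f).symm
    rw [e]
    have h1 : ‖T‖ * (ε / (‖T‖ + 1)) ≤ ε := by
      rw [mul_div_assoc', div_le_iff₀ (by positivity)]
      nlinarith [norm_nonneg T]
    calc ‖Derived.mk A z m (T f)‖ ≤ ‖T f‖ := Derived.norm_mk_le _
      _ ≤ ‖T‖ * ‖f‖ := T.le_opNorm f
      _ ≤ ‖T‖ * (‖x‖ + ε / (‖T‖ + 1)) := by gcongr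
      _ ≤ ‖T‖ * ‖x‖ + ε := by rw [mul_add]; linarith

end AdmissibleSpace

/-- A bounded operator `u : A → B` is strictly cosingular if, for every closed subspace `C` of `B`
of infinite codimension, the composition `A → B → B ⧸ C` is not onto. -/
def StrictlyCosingular {A B : Type*} [NormedAddCommGroup A] [NormedSpace ℂ A]
    [NormedAddCommGroup B] [NormedSpace ℂ B] (u : A →L[ℂ] B) : Prop :=
  ∀ C : Submodule ℂ B, IsClosed (C : Set B) → ¬ FiniteDimensional ℂ (B ⧸ C) →
    ¬ Function.Surjective fun a : A => C.mkQ (u a)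

/-!
Let `φ` be a conformal equivalence of `U` onto the disc with `φ z = 0`. By admissibility,
multiplication by `φ` is an isometry `M` of the admissible space `𝓕` onto the subspace `N` of
functions vanishing at `z` (`exists_isometry_mul`, `exists_isometry_mul_eq`). In terms of `M`, the
strict cosingularity of `𝓩⁽¹⁾ → 𝓩⁽²⁾` says that a closed subspace `D ⊇ M² 𝓕` with `D + N = 𝓕` has
finite codimension, and that of `𝓩⁽ᵏ⁾ → 𝓩⁽ⁿ⁾` follows from the same property with `Mⁿ 𝓕` in place
of `M² 𝓕`, because the image of the inclusion consists of classes of functions vanishing at `z`.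

The property for `Mⁿ` is proved by induction on `n`
(`LinearIsometry.finiteDimensional_quotient_of_pow`). Let `C ⊇ Mⁿ⁺¹ 𝓕` be closed with `C + N = 𝓕`.
If `C + M² 𝓕` has finite codimension, add a finite-dimensional `F` so that `C + F + M² 𝓕 = 𝓕`;
then `M⁻¹(C + F)` is closed, contains `Mⁿ 𝓕` and spans with `N`, so it has finite codimension by
induction. Hence `C + F` has finite codimension in `C + N = 𝓕`, and so has `C`.

That `C + M² 𝓕` has finite codimension is a form of the stability of surjections modulo finite
dimensions under strictly cosingular perturbations (`Submodule.finiteDimensional_quotient_sup`).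
Were the codimension infinite, Hahn–Banach separation would provide, outside any finite-dimensional
obstruction, norm-one functionals annihilating `M² 𝓕` and as small as desired on `C`. They can be
chosen in a biorthogonal system, whose common kernel is a closed subspace `D ⊇ M² 𝓕` of infinite
codimension from which the unit ball of `C` has arbitrarily small distance
(`Submodule.exists_closed_approx`). Then `D + N = 𝓕` still holds, by successive approximation,
contrary to the hypothesis.
-/

/-! ### Sums of closed subspaces -/

section BanachSubspaces

/-- If every point is approximated by the image of a point of controlled norm, up to half its own
norm, then summing the successive corrections solves the equation exactly. -/
theorem ContinuousLinearMap.surjective_of_approx {X Y : Type*}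
    [NormedAddCommGroup X] [NormedSpace ℂ X] [CompleteSpace X]
    [NormedAddCommGroup Y] [NormedSpace ℂ Y] (T : X →L[ℂ] Y) (K : ℝ)
    (hT : ∀ y, ∃ x, ‖x‖ ≤ K * ‖y‖ ∧ ‖y - T x‖ ≤ ‖y‖ / 2) : Function.Surjective T := by
  choose g hg hg' using hT
  intro y
  set r : ℕ → Y := fun n => (fun v => v - T (g v))^[n] y with hr
  have hr_succ : ∀ n, r (n + 1) = r n - T (g (r n)) := fun n => by
    simp only [hr, Function.iterate_succ_apply']
  have hr_le : ∀ n, ‖r n‖ ≤ ‖y‖ * (1 / 2) ^ n := by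
    intro n
    induction n with
    | zero => simp [hr]
    | succ n ih =>
      rw [hr_succ, pow_succ]
      linarith [hg' (r n)]
  have hr_lim : Tendsto r atTop (𝓝 0) := by
    refine squeeze_zero_norm hr_le ?_
    simpa using (tendsto_pow_atTop_nhds_zero_of_lt_one (r := (1 / 2 : ℝ)) (by norm_num)
      (by norm_num)).const_mul ‖y‖
  have hsum : Summable fun n => g (r n) := by
    refine Summable.of_norm_bounded (g := fun n => |K| * (‖y‖ * (1 / 2) ^ n))
      ((summable_geometric_two.mul_left ‖y‖).mul_left |K|) fun n => ?_
    calc ‖g (r n)‖ ≤ K * ‖r n‖ := hg _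
      _ ≤ |K| * ‖r n‖ := by gcongr; exact le_abs_self K
      _ ≤ _ := by gcongr; exact hr_le n
  refine ⟨∑' n, g (r n), ?_⟩
  have h1 := (hsum.hasSum.mapL T).tendsto_sum_nat
  have h2 : ∀ n, ∑ i ∈ Finset.range n, T (g (r i)) = y - r n := by
    intro n
    induction n with
    | zero => simp [hr]
    | succ n ih => rw [Finset.sum_range_succ, ih, hr_succ]; abel
  simp only [h2] at h1
  simpa using tendsto_nhds_unique h1 (hr_lim.const_sub y)

variable {E : Type*} [NormedAddCommGroup E] [NormedSpace ℂ E]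

theorem Submodule.finiteDimensional_quotient_of_sup_eq_top (C F : Submodule ℂ E)
    [FiniteDimensional ℂ F] (h : C ⊔ F = ⊤) : FiniteDimensional ℂ (E ⧸ C) := by
  refine Module.Finite.of_surjective (C.mkQ ∘ₗ F.subtype) fun x => ?_
  obtain ⟨y, rfl⟩ := C.mkQ_surjective x
  obtain ⟨c, hc, f, hf, rfl⟩ := Submodule.mem_sup.1 (h ▸ Submodule.mem_top : y ∈ C ⊔ F)
  refine ⟨⟨f, hf⟩, ?_⟩
  simpa using hc

theorem Submodule.exists_finiteDimensional_sup_eq_top (C : Submodule ℂ E)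
    [FiniteDimensional ℂ (E ⧸ C)] : ∃ F : Submodule ℂ E, FiniteDimensional ℂ F ∧ C ⊔ F = ⊤ := by
  obtain ⟨F, hF⟩ := C.exists_isCompl
  exact ⟨F, (C.quotientEquivOfIsCompl F hF).finiteDimensional, hF.sup_eq_top⟩

theorem Submodule.exists_add_eq_of_sup_eq_top {C P : Submodule ℂ E} (h : C ⊔ P = ⊤) (y : E) :
    ∃ c ∈ C, ∃ p ∈ P, c + p = y :=
  Submodule.mem_sup.1 (h ▸ Submodule.mem_top)

/-- A bound for the real part of `f` on the multiples `t • x` with `‖t‖ ≤ r` is a bound for the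
modulus there: take `t` with the phase that makes `f (t • x)` real and nonnegative. -/
theorem ContinuousLinearMap.mul_norm_le_of_re_le (f : E →L[ℂ] ℂ) {x : E} {r u : ℝ} (hr : 0 ≤ r)
    (h : ∀ t : ℂ, ‖t‖ ≤ r → (f (t • x)).re ≤ u) : r * ‖f x‖ ≤ u := by
  by_cases h0 : f x = 0
  · simpa [h0] using h 0 (by simpa using hr)
  have hn : (‖f x‖ : ℂ) ≠ 0 := by simpa using h0
  have := h (r * ((starRingEnd ℂ) (f x) / ‖f x‖)) (by
    have : ‖f x‖ ≠ 0 := by simpa using h0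
    simp [abs_of_nonneg hr, this])
  have e : f ((r * ((starRingEnd ℂ) (f x) / ‖f x‖)) • x) = ((r * ‖f x‖ : ℝ) : ℂ) := by
    rw [map_smul, smul_eq_mul]
    push_cast
    field_simp
    rw [mul_assoc, Complex.conj_mul']
  rwa [e, Complex.ofReal_re] at this

variable [CompleteSpace E]

theorem Submodule.sup_eq_top_of_approx {C P : Submodule ℂ E} (hC : IsClosed (C : Set E))
    (hP : IsClosed (P : Set E)) (K : ℝ)
    (h : ∀ y, ∃ c ∈ C, ∃ p ∈ P, ‖c‖ ≤ K * ‖y‖ ∧ ‖y - (c + p)‖ ≤ ‖y‖ / 2) : C ⊔ P = ⊤ := by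
  have := hC.completeSpace_coe
  have := hP.completeSpace_coe
  have hs : Function.Surjective (C.subtypeL.coprod P.subtypeL) := by
    refine ContinuousLinearMap.surjective_of_approx _ (K + 3 / 2) fun y => ?_
    obtain ⟨c, hc, p, hp, h1, h2⟩ := h y
    refine ⟨(⟨c, hc⟩, ⟨p, hp⟩), ?_, by simpa using h2⟩
    have h3 : ‖p‖ ≤ (K + 3 / 2) * ‖y‖ := by
      calc ‖p‖ = ‖y - c - (y - (c + p))‖ := by congr 1; abel
        _ ≤ ‖y‖ + ‖c‖ + ‖y - (c + p)‖ := (norm_sub_le _ _).trans (by gcongr; exact norm_sub_le _ _)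
        _ ≤ (K + 3 / 2) * ‖y‖ := by linarith
    have h4 : ‖c‖ ≤ (K + 3 / 2) * ‖y‖ := by nlinarith [norm_nonneg y]
    simpa [Prod.norm_def] using ⟨h4, h3⟩
  refine eq_top_iff.2 fun y _ => ?_
  obtain ⟨x, rfl⟩ := hs y
  simpa using Submodule.add_mem_sup x.1.2 x.2.2

theorem Submodule.exists_bounded_decomposition {C P : Submodule ℂ E} (hC : IsClosed (C : Set E))
    (hP : IsClosed (P : Set E)) (h : C ⊔ P = ⊤) :
    ∃ K > 0, ∀ y, ∃ c ∈ C, ∃ p ∈ P, ‖c‖ ≤ K * ‖y‖ ∧ c + p = y := by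
  have := hC.completeSpace_coe
  have := hP.completeSpace_coe
  have hs : Function.Surjective (C.subtypeL.coprod P.subtypeL) := fun y => by
    obtain ⟨c, hc, p, hp, rfl⟩ := Submodule.exists_add_eq_of_sup_eq_top h y
    exact ⟨(⟨c, hc⟩, ⟨p, hp⟩), by simp⟩
  obtain ⟨K, hK, hx⟩ := ContinuousLinearMap.exists_preimage_norm_le _ hs
  refine ⟨K, hK, fun y => ?_⟩
  obtain ⟨x, rfl, hle⟩ := hx y
  exact ⟨x.1, x.1.2, x.2, x.2.2, (norm_fst_le x).trans hle, by simp⟩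

open scoped Pointwise in
/-- If two closed subspaces do not span, then some norm-one functional annihilates one of them and
is as small as desired on the other.  Otherwise, by separation, balls of the first subspace plus
the second would be dense in balls of the space, and iteration would make the sum everything. -/
theorem Submodule.exists_annihilator_small {C P : Submodule ℂ E} (hC : IsClosed (C : Set E))
    (hP : IsClosed (P : Set E)) (h : C ⊔ P ≠ ⊤) {δ : ℝ} (hδ : 0 < δ) :
    ∃ f : E →L[ℂ] ℂ, ‖f‖ = 1 ∧ (∀ p ∈ P, f p = 0) ∧ ∀ c ∈ C, ‖f c‖ ≤ δ * ‖c‖ := by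
  by_contra hno
  refine h (Submodule.sup_eq_top_of_approx hC hP δ⁻¹ fun y => ?_)
  rcases eq_or_ne y 0 with rfl | hy
  · exact ⟨0, zero_mem _, 0, zero_mem _, by simp, by simp⟩
  have hy' : 0 < ‖y‖ := norm_pos_iff.2 hy
  set R := δ⁻¹ * ‖y‖ with hR
  have hR0 : 0 < R := by positivity
  set S : Set E := ((C : Set E) ∩ Metric.closedBall 0 R) + (P : Set E) with hS
  by_cases hyS : y ∈ closure S
  · obtain ⟨b, ⟨c, ⟨hc, hcR⟩, p, hp, rfl⟩, hb⟩ :=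
      Metric.mem_closure_iff.1 hyS (‖y‖ / 2) (by positivity)
    exact ⟨c, hc, p, hp, by simpa using hcR, by simpa [dist_eq_norm] using hb.le⟩
  exfalso
  have hconv : Convex ℝ S :=
    ((C.restrictScalars ℝ).convex.inter (convex_closedBall _ _)).add (P.restrictScalars ℝ).convex
  obtain ⟨f, u, hfS, hfy⟩ := RCLike.geometric_hahn_banach_closed_point (𝕜 := ℂ)
    hconv.closure isClosed_closure hyS
  have hu : ∀ c ∈ C, ‖c‖ ≤ R → ∀ p ∈ P, (f (c + p)).re ≤ u := fun c hc hcR p hp =>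
    (hfS _ (subset_closure ⟨c, ⟨hc, by simpa using hcR⟩, p, hp, rfl⟩)).le
  have hfP : ∀ p ∈ P, f p = 0 := by
    intro p hp
    by_contra h0
    have h0' : 0 < ‖f p‖ := norm_pos_iff.2 h0
    have := f.mul_norm_le_of_re_le (x := p) (r := (|u| + 1) / ‖f p‖) (u := u) (by positivity)
      fun t _ => by simpa using hu 0 (zero_mem _) (by simpa using hR0.le) _ (P.smul_mem t hp)
    rw [div_mul_cancel₀ _ h0'.ne'] at this
    linarith [le_abs_self u]
  have hfpos : 0 < ‖f‖ := by
    refine norm_pos_iff.2 fun h0 => ?_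
    have := hu 0 (zero_mem _) (by simpa using hR0.le) 0 (zero_mem _)
    rw [h0] at this hfy
    simp only [zero_apply, Complex.zero_re, map_zero] at this hfy
    linarith
  have hufy : u ≤ ‖f‖ * ‖y‖ :=
    hfy.le.trans ((Complex.re_le_norm _).trans (f.le_opNorm y))
  have hfC : ∀ c ∈ C, ‖f c‖ ≤ δ * ‖f‖ * ‖c‖ := by
    intro c hc
    rcases eq_or_ne c 0 with rfl | hc0
    · simp
    have hc' : 0 < ‖c‖ := norm_pos_iff.2 hc0
    have := f.mul_norm_le_of_re_le (x := c) (r := R / ‖c‖) (u := u) (by positivity)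
      fun t ht => by
        simpa using hu (t • c) (C.smul_mem t hc) (by
          rw [norm_smul]; exact (le_div_iff₀ hc').1 ht) 0 (zero_mem _)
    have h2 := this.trans hufy
    rw [hR, div_mul_eq_mul_div, div_le_iff₀ hc', mul_assoc, inv_mul_le_iff₀ hδ] at h2
    nlinarith
  refine hno ⟨((‖f‖⁻¹ : ℝ) : ℂ) • f, ?_, fun p hp => by simp [hfP p hp], fun c hc => ?_⟩
  · simp [norm_smul, hfpos.ne']
  · have := hfC c hc
    simp only [smul_apply, norm_smul, Complex.norm_real, norm_inv, norm_norm]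
    rw [inv_mul_le_iff₀ hfpos]
    linarith

/-! ### Perturbation of closed subspaces of infinite codimension -/

/-- One step of a biorthogonal construction: given finitely many vectors `y` and functionals `g`,
there are a further functional `f` annihilating `L` and all the given vectors, and a vector `v`
with `f v = 1` annihilated by all the given functionals, such that `‖f‖ ‖v‖` is small over `C`.
The bound for `v` comes from a projection onto the common kernel of the given functionals whose
kernel is also annihilated by `f`, so it is known before `f` is chosen. -/
theorem Submodule.exists_biorthogonal_extension {C L : Submodule ℂ E} (hC : IsClosed (C : Set E))
    (hL : IsClosed (L : Set E)) (h : ¬ FiniteDimensional ℂ (E ⧸ (C ⊔ L)))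
    (s : Finset ((E →L[ℂ] ℂ) × E)) {η : ℝ} (hη : 0 < η) :
    ∃ (f : E →L[ℂ] ℂ) (v : E), (∀ x ∈ L, f x = 0) ∧ f v = 1 ∧ (∀ q ∈ s, f q.2 = 0) ∧
      (∀ q ∈ s, q.1 v = 0) ∧ ∀ c ∈ C, ‖f c‖ * ‖v‖ ≤ η * ‖c‖ := by
  classical
  let G : E →L[ℂ] (s → ℂ) := ContinuousLinearMap.pi fun q => q.1.1
  let Z : Submodule ℂ E := LinearMap.ker (G : E →ₗ[ℂ] (s → ℂ))
  have hZc : IsClosed (Z : Set E) := G.isClosed_ker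
  have : FiniteDimensional ℂ (E ⧸ Z) :=
    (G : E →ₗ[ℂ] (s → ℂ)).quotKerEquivRange.symm.finiteDimensional
  obtain ⟨p, hp⟩ := Submodule.ClosedComplemented.of_finiteDimensional_quotient hZc
  have hcompl : IsCompl Z (LinearMap.ker (p : E →ₗ[ℂ] Z)) := LinearMap.isCompl_of_proj hp
  have : FiniteDimensional ℂ (LinearMap.ker (p : E →ₗ[ℂ] Z)) :=
    (Z.quotientEquivOfIsCompl _ hcompl).finiteDimensional
  have : FiniteDimensional ℂ (Submodule.span ℂ ((s.image Prod.snd : Finset E) : Set E)) :=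
    FiniteDimensional.span_finset ℂ _
  set V := Submodule.span ℂ ((s.image Prod.snd : Finset E) : Set E) ⊔
    LinearMap.ker (p : E →ₗ[ℂ] Z) with hV
  have hLV : IsClosed ((L ⊔ V : Submodule ℂ E) : Set E) := L.isClosed_sup_finiteDimensional V hL
  have hne : C ⊔ (L ⊔ V) ≠ ⊤ := fun ht => h <|
    Submodule.finiteDimensional_quotient_of_sup_eq_top (C ⊔ L) V (by rwa [sup_assoc])
  obtain ⟨f, hf1, hfP, hfC⟩ := Submodule.exists_annihilator_small hC hLV hne
    (δ := η / (2 * (‖p‖ + 1))) (by positivity)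
  obtain ⟨y, hy, hfy⟩ : ∃ y : E, ‖y‖ ≤ 2 ∧ f y = 1 := by
    obtain ⟨x, hx1, hx⟩ := f.exists_lt_apply_of_lt_opNorm (r := 1 / 2) (by rw [hf1]; norm_num)
    have hx0 : f x ≠ 0 := by
      intro h0; rw [h0, norm_zero] at hx; norm_num at hx
    refine ⟨(f x)⁻¹ • x, ?_, by simp [hx0]⟩
    rw [norm_smul, norm_inv, inv_mul_le_iff₀ (norm_pos_iff.2 hx0)]
    linarith
  have hker : f (y - p y) = 0 := by
    refine hfP _ (Submodule.mem_sup_right (Submodule.mem_sup_right ?_))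
    simp [hp]
  refine ⟨f, p y, fun x hx => hfP x (Submodule.mem_sup_left hx), ?_, fun q hq => ?_, fun q hq => ?_,
    fun c hc => ?_⟩
  · rw [map_sub, sub_eq_zero] at hker
    rw [← hker, hfy]
  · exact hfP _ (Submodule.mem_sup_right (Submodule.mem_sup_left (Submodule.subset_span
      (by simpa using ⟨q.1, hq⟩))))
  · exact congrFun (show G (p y) = 0 from (p y).2) ⟨q, hq⟩
  · have hpy : ‖((p y : Z) : E)‖ ≤ 2 * (‖p‖ + 1) := by
      have := p.le_opNorm y
      change ‖p y‖ ≤ _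
      nlinarith [norm_nonneg p, norm_nonneg y]
    calc ‖f c‖ * ‖((p y : Z) : E)‖ ≤ (η / (2 * (‖p‖ + 1)) * ‖c‖) * (2 * (‖p‖ + 1)) := by
          gcongr; exact hfC c hc
      _ = η * ‖c‖ := by field_simp

/-- If `C + L` has infinite codimension, then `C` lies, up to a small relative error, in a closed
subspace of infinite codimension that contains `L`: the common kernel of the functionals of
a biorthogonal system `(f n, y n)` for which `c ↦ ∑ f n c • y n` is small on `C`. -/
theorem Submodule.exists_closed_approx {C L : Submodule ℂ E} (hC : IsClosed (C : Set E))
    (hL : IsClosed (L : Set E)) (h : ¬ FiniteDimensional ℂ (E ⧸ (C ⊔ L))) {ε : ℝ} (hε : 0 < ε) :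
    ∃ D : Submodule ℂ E, IsClosed (D : Set E) ∧ L ≤ D ∧ ¬ FiniteDimensional ℂ (E ⧸ D) ∧
      ∀ c ∈ C, ∃ d ∈ D, ‖c - d‖ ≤ ε * ‖c‖ := by
  classical
  -- The entries are triples `((f, y), η)`, where `η` bounds `‖f‖ ‖y‖` on `C` and at least halves
  -- from each entry to the next.
  obtain ⟨q, hq, hqq⟩ := exists_seq_of_forall_finset_exists
    (fun a : ((E →L[ℂ] ℂ) × E) × ℝ => 0 < a.2 ∧ a.2 ≤ ε / 2 ∧ (∀ x ∈ L, a.1.1 x = 0) ∧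
      a.1.1 a.1.2 = 1 ∧ ∀ c ∈ C, ‖a.1.1 c‖ * ‖a.1.2‖ ≤ a.2 * ‖c‖)
    (fun a b => b.2 ≤ a.2 / 2 ∧ b.1.1 a.1.2 = 0 ∧ a.1.1 b.1.2 = 0) (by
      intro s hs
      obtain ⟨η, hη, hηε, hηs⟩ : ∃ η : ℝ, 0 < η ∧ η ≤ ε / 2 ∧ ∀ a ∈ s, η ≤ a.2 / 2 := by
        have hne : (insert ε (s.image Prod.snd)).Nonempty := Finset.insert_nonempty _ _
        have hpos : 0 < (insert ε (s.image Prod.snd)).min' hne := by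
          rw [Finset.lt_min'_iff]
          intro b hb
          rcases Finset.mem_insert.1 hb with rfl | hb
          · exact hε
          · obtain ⟨a, ha, rfl⟩ := Finset.mem_image.1 hb
            exact (hs a ha).1
        refine ⟨_, half_pos hpos, ?_, fun a ha => ?_⟩
        · gcongr
          exact Finset.min'_le _ _ (Finset.mem_insert_self _ _)
        · gcongr
          exact Finset.min'_le _ _ (Finset.mem_insert_of_mem (Finset.mem_image_of_mem _ ha))
      obtain ⟨f, v, h1, h2, h3, h4, h5⟩ :=
        Submodule.exists_biorthogonal_extension hC hL h (s.image Prod.fst) hη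
      exact ⟨((f, v), η), ⟨hη, hηε, h1, h2, h5⟩, fun a ha => ⟨hηs a ha,
        h3 _ (Finset.mem_image_of_mem _ ha), h4 _ (Finset.mem_image_of_mem _ ha)⟩⟩)
  set f : ℕ → E →L[ℂ] ℂ := fun n => (q n).1.1 with hf
  set y : ℕ → E := fun n => (q n).1.2 with hy
  have hbi : ∀ m n, f m (y n) = if n = m then 1 else 0 := by
    intro m n
    rcases lt_trichotomy m n with hmn | rfl | hmn
    · rw [if_neg hmn.ne']; exact (hqq m n hmn).2.2
    · rw [if_pos rfl]; exact (hq m).2.2.2.1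
    · rw [if_neg hmn.ne]; exact (hqq n m hmn).2.1
  have hsmall : ∀ n, (q n).2 ≤ ε / 2 * (1 / 2) ^ n := by
    intro n
    induction n with
    | zero => simpa using (hq 0).2.1
    | succ n ih =>
      have := (hqq n (n + 1) n.lt_succ_self).1
      rw [pow_succ]; linarith
  have hterm : ∀ c ∈ C, ∀ n, ‖f n c • y n‖ ≤ ε / 2 * ‖c‖ * (1 / 2) ^ n := by
    intro c hc n
    rw [norm_smul]
    refine ((hq n).2.2.2.2 c hc).trans ?_
    have := mul_le_mul_of_nonneg_right (hsmall n) (norm_nonneg c)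
    linarith
  refine ⟨⨅ n, LinearMap.ker (f n : E →ₗ[ℂ] ℂ), ?_,
    le_iInf fun n x hx => (hq n).2.2.1 x hx, ?_, ?_⟩
  · rw [Submodule.coe_iInf]
    exact isClosed_iInter fun n => (f n).isClosed_ker
  · intro hfin
    have hli : LinearIndependent ℂ fun n => (⨅ n, LinearMap.ker (f n : E →ₗ[ℂ] ℂ)).mkQ (y n) := by
      rw [linearIndependent_iff']
      intro s a ha m hm
      have h1 : (⨅ n, LinearMap.ker (f n : E →ₗ[ℂ] ℂ)).mkQ (∑ n ∈ s, a n • y n) = 0 := by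
        simpa using ha
      rw [Submodule.mkQ_apply, Submodule.Quotient.mk_eq_zero, Submodule.mem_iInf] at h1
      have h2 := h1 m
      simpa [hbi, hm] using h2
    exact not_finite_iff_infinite.2 inferInstance (hli.finite : Finite ℕ)
  · intro c hc
    have hb : Summable fun n : ℕ => ε / 2 * ‖c‖ * (1 / 2) ^ n :=
      summable_geometric_two.mul_left _
    have hs : Summable fun n => f n c • y n := Summable.of_norm_bounded hb (hterm c hc)
    refine ⟨c - ∑' n, f n c • y n, ?_, ?_⟩
    · refine (Submodule.mem_iInf _).2 fun m => ?_
      change f m (c - ∑' n, f n c • y n) = 0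
      rw [map_sub, (f m).map_tsum hs]
      simp [hbi]
    · rw [sub_sub_cancel]
      refine (tsum_of_norm_bounded hb.hasSum (hterm c hc)).trans ?_
      rw [tsum_mul_left, tsum_geometric_two]
      linarith

/-- Suppose that every closed `D ⊇ L` spanning together with `N` has finite codimension. The closure
of `C + L` is such a `D` if `C` spans together with `N`, but the point is that already `C + L`, not
known to be closed, has finite codimension: otherwise some closed `D ⊇ L` of infinite codimension
lies so close to `C` that it still spans together with `N`. -/
theorem Submodule.finiteDimensional_quotient_sup {C N L : Submodule ℂ E}
    (hC : IsClosed (C : Set E)) (hN : IsClosed (N : Set E)) (hL : IsClosed (L : Set E))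
    (h : ∀ D : Submodule ℂ E, IsClosed (D : Set E) → L ≤ D → D ⊔ N = ⊤ →
      FiniteDimensional ℂ (E ⧸ D))
    (hCN : C ⊔ N = ⊤) : FiniteDimensional ℂ (E ⧸ (C ⊔ L)) := by
  by_contra hinf
  obtain ⟨K, hK, hdec⟩ := Submodule.exists_bounded_decomposition hC hN hCN
  obtain ⟨D, hD, hLD, hDinf, happ⟩ :=
    Submodule.exists_closed_approx hC hL hinf (ε := (2 * K)⁻¹) (by positivity)
  refine hDinf (h D hD hLD (Submodule.sup_eq_top_of_approx hD hN (K + 1 / 2) fun y => ?_))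
  obtain ⟨c, hc, p, hp, hle, hy⟩ := hdec y
  obtain ⟨d, hd, hcd⟩ := happ c hc
  have h1 : ‖c - d‖ ≤ ‖y‖ / 2 := by
    calc ‖c - d‖ ≤ (2 * K)⁻¹ * ‖c‖ := hcd
      _ ≤ (2 * K)⁻¹ * (K * ‖y‖) := by gcongr
      _ = ‖y‖ / 2 := by field_simp
  refine ⟨d, hd, p, hp, ?_, ?_⟩
  · have := norm_sub_le c (c - d)
    rw [sub_sub_cancel] at this
    linarith
  · rwa [← hy, add_sub_add_right_eq_sub, hy]

/-! ### Induction along the powers of an isometry -/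

/-- The induction: the property that closed subspaces containing `range (M ^ n)` and spanning
together with `range M` have finite codimension passes from `n = 2` to every `n`. -/
theorem LinearIsometry.finiteDimensional_quotient_of_pow (M : E →ₗᵢ[ℂ] E)
    (h : ∀ D : Submodule ℂ E, IsClosed (D : Set E) → (∀ f, M (M f) ∈ D) →
      D ⊔ LinearMap.range M.toLinearMap = ⊤ → FiniteDimensional ℂ (E ⧸ D)) (n : ℕ) :
    ∀ C : Submodule ℂ E, IsClosed (C : Set E) → (∀ f, M^[n] f ∈ C) →
      C ⊔ LinearMap.range M.toLinearMap = ⊤ → FiniteDimensional ℂ (E ⧸ C) := by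
  have hN : IsClosed ((LinearMap.range M.toLinearMap : Submodule ℂ E) : Set E) := by
    exact M.isometry.isClosedEmbedding.isClosed_range
  have hL : IsClosed ((LinearMap.range (M.comp M).toLinearMap : Submodule ℂ E) : Set E) := by
    exact (M.comp M).isometry.isClosedEmbedding.isClosed_range
  induction n with
  | zero =>
    intro C _ hmem _
    obtain rfl : C = ⊤ := eq_top_iff.2 fun f _ => hmem f
    exact Submodule.finiteDimensional_quotient_of_sup_eq_top ⊤ ⊥ (by simp)
  | succ n ih =>
    intro C hC hmem hCN
    have := Submodule.finiteDimensional_quotient_sup hC hN hL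
      (fun D hD hLD => h D hD fun f => hLD ⟨f, rfl⟩) hCN
    obtain ⟨F, hF, hCLF⟩ := Submodule.exists_finiteDimensional_sup_eq_top
      (C ⊔ LinearMap.range (M.comp M).toLinearMap)
    -- `C + F` meets `range M` in a space to which, pulled back by `M`, the induction applies.
    have hCF : IsClosed ((C ⊔ F : Submodule ℂ E) : Set E) := C.isClosed_sup_finiteDimensional F hC
    have hfin := ih ((C ⊔ F).comap M.toLinearMap) (hCF.preimage M.continuous)
      (fun f => Submodule.mem_sup_left (by
        have := hmem f
        rwa [Function.iterate_succ_apply'] at this)) (by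
        refine eq_top_iff.2 fun x _ => ?_
        rw [sup_right_comm] at hCLF
        obtain ⟨c, hc, _, ⟨u, rfl⟩, hcu⟩ := Submodule.exists_add_eq_of_sup_eq_top hCLF (M x)
        refine Submodule.mem_sup.2 ⟨x - M u, ?_, M u, ⟨u, rfl⟩, sub_add_cancel _ _⟩
        have : M (x - M u) = c := by
          rw [map_sub, ← hcu]; exact add_sub_cancel_right _ _
        change M (x - M u) ∈ C ⊔ F
        rwa [this])
    obtain ⟨G, hG, hCG⟩ := Submodule.exists_finiteDimensional_sup_eq_top
      ((C ⊔ F).comap M.toLinearMap)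
    refine Submodule.finiteDimensional_quotient_of_sup_eq_top C (F ⊔ G.map M.toLinearMap) ?_
    refine eq_top_iff.2 (hCN ▸ sup_le le_sup_left ?_)
    rw [LinearMap.range_eq_map, ← hCG, Submodule.map_sup, ← sup_assoc]
    exact sup_le_sup_right (Submodule.map_comap_le _ _) _

end BanachSubspaces

/-! ### Conformal equivalences onto the disc -/

/-- An open set conformally equivalent to the disc has, for each of its points, a conformal
equivalence onto the disc vanishing there: compose with a Möbius automorphism of the disc. -/
theorem IsConformalEquivDisc.exists_map_eq_zero {U : Set ℂ} {φ : ℂ → ℂ}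
    (hφ : IsConformalEquivDisc U φ) {z : ℂ} (hz : z ∈ U) :
    ∃ χ : ℂ → ℂ, IsConformalEquivDisc U χ ∧ χ z = 0 := by
  -- The Möbius maps `w ↦ (w - a) / (1 - conj a * w)` for `a` and `-a` are mutually inverse.
  let μ : ℂ → ℂ → ℂ := fun a w => (w - a) / (1 - (starRingEnd ℂ) a * w)
  have hden : ∀ a ∈ Metric.ball (0 : ℂ) 1, ∀ w ∈ Metric.ball (0 : ℂ) 1,
      1 - (starRingEnd ℂ) a * w ≠ 0 := by
    intro a ha w hw h0
    rw [mem_ball_zero_iff] at ha hw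
    have h1 : ‖(starRingEnd ℂ) a * w‖ = 1 := by rw [← sub_eq_zero.1 h0, norm_one]
    rw [norm_mul, RCLike.norm_conj] at h1
    nlinarith [norm_nonneg a, norm_nonneg w]
  have hdiff : ∀ a ∈ Metric.ball (0 : ℂ) 1, DifferentiableOn ℂ (μ a) (Metric.ball 0 1) :=
    fun a ha => DifferentiableOn.div (by fun_prop) (by fun_prop) (hden a ha)
  have hmaps : ∀ a ∈ Metric.ball (0 : ℂ) 1, MapsTo (μ a) (Metric.ball 0 1) (Metric.ball 0 1) := by
    intro a ha w hw
    have h0 := hden a ha w hw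
    rw [mem_ball_zero_iff] at ha hw ⊢
    rw [norm_div, div_lt_one (norm_pos_iff.2 h0)]
    refine lt_of_pow_lt_pow_left₀ 2 (norm_nonneg _) ?_
    have ha2 : ‖a‖ ^ 2 < 1 := by nlinarith [norm_nonneg a]
    have hw2 : ‖w‖ ^ 2 < 1 := by nlinarith [norm_nonneg w]
    have e : ‖1 - (starRingEnd ℂ) a * w‖ ^ 2 - ‖w - a‖ ^ 2 = (1 - ‖a‖ ^ 2) * (1 - ‖w‖ ^ 2) := by
      simp only [← Complex.normSq_eq_norm_sq, Complex.normSq_apply, Complex.sub_re, Complex.sub_im,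
        Complex.mul_re, Complex.mul_im, Complex.conj_re, Complex.conj_im, Complex.one_re,
        Complex.one_im]
      ring
    nlinarith [mul_pos (sub_pos.2 ha2) (sub_pos.2 hw2)]
  have hinv : ∀ a ∈ Metric.ball (0 : ℂ) 1, LeftInvOn (μ (-a)) (μ a) (Metric.ball 0 1) := by
    intro a ha w hw
    have h0 := hden a ha w hw
    have h1 := hden a ha a ha
    have h2 : 1 + (starRingEnd ℂ) a * ((w - a) / (1 - (starRingEnd ℂ) a * w)) ≠ 0 := by
      have : 1 + (starRingEnd ℂ) a * ((w - a) / (1 - (starRingEnd ℂ) a * w)) =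
          (1 - (starRingEnd ℂ) a * a) / (1 - (starRingEnd ℂ) a * w) := by
        field_simp; ring
      rw [this]
      exact div_ne_zero h1 h0
    simp only [μ, map_neg, neg_mul, sub_neg_eq_add]
    rw [div_eq_iff h2]
    linear_combination div_mul_cancel₀ (w - a) h0
  obtain ⟨hd, hb, θ, hθ, hθinv⟩ := hφ
  set a := φ z
  have ha : a ∈ Metric.ball (0 : ℂ) 1 := hb.mapsTo hz
  have hna : -a ∈ Metric.ball (0 : ℂ) 1 := by simpa using ha
  have hinv' : RightInvOn (μ (-a)) (μ a) (Metric.ball 0 1) := by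
    have := hinv (-a) hna
    rwa [neg_neg] at this
  have hμ : BijOn (μ a) (Metric.ball 0 1) (Metric.ball 0 1) :=
    InvOn.bijOn ⟨hinv a ha, hinv'⟩ (hmaps a ha) (hmaps _ hna)
  have hθmaps : MapsTo θ (Metric.ball 0 1) U := by
    intro w hw
    obtain ⟨u, hu, rfl⟩ := hb.surjOn hw
    rwa [hθinv.1 hu]
  refine ⟨μ a ∘ φ, ⟨(hdiff a ha).comp hd hb.mapsTo, hμ.comp hb, θ ∘ μ (-a),
    hθ.comp (hdiff _ hna) (hmaps _ hna), ?_, ?_⟩, by simp [μ, a]⟩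
  · intro w hw
    have := hinv a ha (hb.mapsTo hw)
    simp only [Function.comp_apply, this]
    exact hθinv.1 hw
  · intro w hw
    simp only [Function.comp_apply]
    rw [hθinv.2 (hmaps _ hna hw)]
    exact hinv' hw

/-- The difference quotient of a conformal equivalence has no zeros. -/
theorem IsConformalEquivDisc.dslope_ne_zero {U : Set ℂ} {φ : ℂ → ℂ} (hU : IsOpen U)
    (hφ : IsConformalEquivDisc U φ) {z : ℂ} (hz : z ∈ U) {w : ℂ} (hw : w ∈ U) :
    dslope φ z w ≠ 0 := by
  obtain ⟨hd, hb, θ, hθ, hinv⟩ := hφ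
  rcases eq_or_ne w z with rfl | hne
  · rw [dslope_same]
    have hdφ : DifferentiableAt ℂ φ w := (hd w hw).differentiableAt (hU.mem_nhds hw)
    have h1 := ((hθ (φ w) (hb.mapsTo hw)).differentiableAt
      (Metric.isOpen_ball.mem_nhds (hb.mapsTo hw))).hasDerivAt.comp w hdφ.hasDerivAt
    have h2 : θ ∘ φ =ᶠ[𝓝 w] id :=
      (show EqOn (θ ∘ φ) id U from fun w hw => hinv.1 hw).eventuallyEq_of_mem (hU.mem_nhds hw)
    have h3 := h1.unique ((hasDerivAt_id w).congr_of_eventuallyEq h2)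
    intro h0
    rw [h0, mul_zero] at h3
    exact zero_ne_one h3
  · rw [dslope_of_ne _ hne, slope_def_field]
    exact div_ne_zero (sub_ne_zero.2 fun h => hne (hb.injOn hw hz h)) (sub_ne_zero.2 hne)

/-! ### Multiplication by a conformal equivalence and Taylor coefficients -/

section

variable {W : Type*} [NormedAddCommGroup W] [NormedSpace ℂ W]

@[simp]
theorem taylorCoeff_zero (F : ℂ → W) (z : ℂ) : taylorCoeff F 0 z = F z := by
  simp [taylorCoeff]

theorem taylorCoeff_one (F : ℂ → W) (z : ℂ) : taylorCoeff F 1 z = deriv F z := by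
  simp [taylorCoeff, iteratedDeriv_one]

end

namespace AdmissibleSpace

variable {U : Set ℂ} {W 𝓕 : Type*}
  [NormedAddCommGroup W] [NormedSpace ℂ W] [CompleteSpace W]
  [NormedAddCommGroup 𝓕] [NormedSpace ℂ 𝓕] [CompleteSpace 𝓕]

/-- Multiplication by a conformal equivalence is an isometric operator. -/
theorem exists_isometry_mul (A : AdmissibleSpace U W 𝓕) {φ : ℂ → ℂ}
    (hφ : IsConformalEquivDisc U φ) :
    ∃ M : 𝓕 →ₗᵢ[ℂ] 𝓕, ∀ f, ∀ w ∈ U, A.toFun (M f) w = φ w • A.toFun f w := by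
  obtain ⟨T, hT⟩ := IsMultiplier.conformal A hφ
  exact ⟨⟨T.toLinearMap, fun f => A.norm_mul φ hφ f (T f) (hT f)⟩, hT⟩

/-- A function of the space vanishing at the zero of `φ` is divisible by `φ` in the space: the
quotient is analytic, so that the equivalence in the definition of admissibility applies. -/
theorem exists_isometry_mul_eq (A : AdmissibleSpace U W 𝓕) {φ : ℂ → ℂ}
    (hφ : IsConformalEquivDisc U φ) {z : ℂ} (hz : z ∈ U) (hφz : φ z = 0) {M : 𝓕 → 𝓕}
    (hM : ∀ f, ∀ w ∈ U, A.toFun (M f) w = φ w • A.toFun f w) {f : 𝓕} (hf : A.toFun f z = 0) :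
    ∃ g : 𝓕, M g = f := by
  have hU := A.isOpen.mem_nhds hz
  have e : EqOn (A.toFun f)
      (fun w => φ w • ((dslope φ z w)⁻¹ • dslope (A.toFun f) z w)) U := by
    intro w hw
    have h1 : (w - z) * dslope φ z w = φ w := by simpa [hφz] using sub_smul_dslope φ z w
    have h2 : (w - z) • dslope (A.toFun f) z w = A.toFun f w := by simp [hf]
    have h3 := hφ.dslope_ne_zero A.isOpen hz hw
    simp only [← h1, smul_smul, mul_inv_cancel_right₀ h3, h2]
  obtain ⟨g, hg⟩ := (A.mul_mem_iff φ hφ _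
    ((((Complex.differentiableOn_dslope hU).2 hφ.1).inv fun w hw =>
      hφ.dslope_ne_zero A.isOpen hz hw).smul
      ((Complex.differentiableOn_dslope hU).2 (A.analytic f)))).2 ⟨f, e⟩
  exact ⟨g, A.ext_on _ _ fun w hw => by rw [hM g w hw, e hw, hg hw]; rfl⟩

@[simp]
theorem taylorList_apply (A : AdmissibleSpace U W 𝓕) (z : U) (n : ℕ) (f : 𝓕) (j : Fin n) :
    A.taylorList z n f j = taylorCoeff (A.toFun f) (n - 1 - (j : ℕ)) z := rfl

theorem taylorCoeff_one_mul (A : AdmissibleSpace U W 𝓕) {φ : ℂ → ℂ}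
    (hφ : IsConformalEquivDisc U φ) {z : ℂ} (hz : z ∈ U) (hφz : φ z = 0) {f g : 𝓕}
    (h : ∀ w ∈ U, A.toFun f w = φ w • A.toFun g w) :
    taylorCoeff (A.toFun f) 1 z = deriv φ z • A.toFun g z := by
  have hU := A.isOpen.mem_nhds hz
  have e : EqOn (A.toFun f) (fun w => φ w • A.toFun g w) U := h
  rw [taylorCoeff_congr A.isOpen hz e, taylorCoeff_one]
  refine (((hφ.1 z hz).differentiableAt hU).hasDerivAt.smul
    (((A.analytic g) z hz).differentiableAt hU).hasDerivAt).deriv.trans ?_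
  simp [hφz]

/-- Multiplying `n` times by a function with a zero at `z` kills the first `n` Taylor
coefficients. -/
theorem taylorList_iterate_mul (A : AdmissibleSpace U W 𝓕) {φ : ℂ → ℂ}
    (hφ : DifferentiableOn ℂ φ U) (z : U) (hφz : φ z = 0) {M : 𝓕 → 𝓕}
    (hM : ∀ f, ∀ w ∈ U, A.toFun (M f) w = φ w • A.toFun f w) (n : ℕ) (f : 𝓕) :
    A.taylorList z n (M^[n] f) = 0 := by
  have hU := A.isOpen.mem_nhds z.2
  have hpow : ∀ m, ∀ w ∈ U, A.toFun (M^[m] f) w = φ w ^ m • A.toFun f w := by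
    intro m
    induction m with
    | zero => simp
    | succ m ih =>
      intro w hw
      rw [Function.iterate_succ_apply', hM _ w hw, ih w hw, smul_smul, pow_succ']
  have e : EqOn (A.toFun (M^[n] f))
      (fun w => (w - (z : ℂ)) ^ n • (dslope φ z w ^ n • A.toFun f w)) U := by
    intro w hw
    have h1 : (w - z) * dslope φ z w = φ w := by simpa [hφz] using sub_smul_dslope φ (z : ℂ) w
    simp only [hpow n w hw, smul_smul, ← mul_pow, h1]
  funext j
  have hj := j.2
  rw [taylorList_apply, taylorCoeff_congr A.isOpen z.2 e]
  exact taylorCoeff_sub_pow_smul A.isOpen z.2 n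
    ((((Complex.differentiableOn_dslope hU).2 hφ).pow n).smul (A.analytic f)) _ (by omega)

/-! ### The quotient map onto `𝓩⁽ⁿ⁾` -/

namespace Derived

/-- The quotient map from the admissible space onto `𝓩⁽ⁿ⁾`, as a bounded operator. -/
noncomputable def mkL (A : AdmissibleSpace U W 𝓕) (z : U) (n : ℕ) : 𝓕 →L[ℂ] A.Derived z n :=
  LinearMap.mkContinuous
    { toFun := mk A z n
      map_add' := fun f g => Subtype.ext (map_add (A.taylorList z n) f g)
      map_smul' := fun c f => Subtype.ext (map_smul (A.taylorList z n) c f) } 1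
    fun f => by rw [one_mul]; exact norm_mk_le f

variable {A : AdmissibleSpace U W 𝓕} {z : U} {n : ℕ}

theorem list_mkL (f : 𝓕) : (mkL A z n f).list = A.taylorList z n f := rfl

theorem list_injective : Function.Injective (list : A.Derived z n → Fin n → W) :=
  Subtype.val_injective

theorem mkL_surjective : Function.Surjective (mkL A z n) := by
  rintro ⟨_, f, rfl⟩
  exact ⟨f, rfl⟩

theorem mkL_eq_zero_iff {f : 𝓕} : mkL A z n f = 0 ↔ A.taylorList z n f = 0 :=
  list_injective.eq_iff.symm

theorem list_incl {m : ℕ} (hnm : n ≤ m) (x : A.Derived z n) :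
    (A.incl z hnm x).list = padRight W n m x.list := rfl

/-- Closed subspaces containing the kernel have closed images, because the quotient norm is an
infimum over preimages, so that the quotient map is open. -/
theorem isClosed_map_mkL {D : Submodule ℂ 𝓕} (hD : IsClosed (D : Set 𝓕))
    (hker : ∀ f, mkL A z n f = 0 → f ∈ D) :
    IsClosed ((D.map (mkL A z n).toLinearMap : Submodule ℂ (A.Derived z n)) :
      Set (A.Derived z n)) := by
  have hmem : ∀ f, mkL A z n f ∈ D.map (mkL A z n).toLinearMap → f ∈ D := by
    rintro f ⟨d, hd, h⟩
    have := hker (f - d) (by rw [map_sub, sub_eq_zero]; exact h.symm)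
    simpa using D.add_mem this hd
  rw [← isOpen_compl_iff, Metric.isOpen_iff]
  intro x hx
  obtain ⟨f, rfl⟩ := mkL_surjective x
  have hf : f ∈ (D : Set 𝓕)ᶜ := fun hf => hx ⟨f, hf, rfl⟩
  obtain ⟨ε, hε, hball⟩ := Metric.isOpen_iff.1 hD.isOpen_compl f hf
  refine ⟨ε, hε, fun y hy hyD => ?_⟩
  rw [Metric.mem_ball, dist_eq_norm] at hy
  obtain ⟨g, hg, hlt⟩ := exists_norm_lt (y - mkL A z n f) (sub_pos.2 hy)
  refine hball (show f + g ∈ Metric.ball f ε by simp; linarith) (hmem _ ?_)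
  have : mkL A z n g = y - mkL A z n f := hg
  rw [map_add, this, add_sub_cancel]
  exact hyD

end Derived

/-! ### Strict cosingularity in terms of closed subspaces of the admissible space -/

open Derived

/-- Since every `f` vanishing at `z` is `φ · g` and `f'(z) = φ'(z) g(z)`, the image of
`𝓩⁽¹⁾ → 𝓩⁽²⁾` is the image of the functions vanishing at `z`; thus strict cosingularity becomes a
property of the closed subspaces of the admissible space that contain all products `φ² · f`. -/
theorem finiteDimensional_quotient_of_strictlyCosingular (A : AdmissibleSpace U W 𝓕) (z : U)
    (h : StrictlyCosingular (A.incl z (n := 1) (m := 2) one_le_two)) {φ : ℂ → ℂ}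
    (hφ : IsConformalEquivDisc U φ) (hφz : φ z = 0) (M : 𝓕 →ₗᵢ[ℂ] 𝓕)
    (hM : ∀ f, ∀ w ∈ U, A.toFun (M f) w = φ w • A.toFun f w)
    (D : Submodule ℂ 𝓕) (hD : IsClosed (D : Set 𝓕)) (hMM : ∀ f, M (M f) ∈ D)
    (hDM : D ⊔ LinearMap.range M.toLinearMap = ⊤) : FiniteDimensional ℂ (𝓕 ⧸ D) := by
  have hφ' : deriv φ z ≠ 0 := by
    simpa using hφ.dslope_ne_zero A.isOpen z.2 z.2
  have hker : ∀ f, mkL A z 2 f = 0 → f ∈ D := by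
    intro f hf
    rw [mkL_eq_zero_iff] at hf
    obtain ⟨g, rfl⟩ := A.exists_isometry_mul_eq hφ z.2 hφz hM
      (by simpa using congrFun hf 1)
    have h1 : taylorCoeff (A.toFun (M g)) 1 z = 0 := congrFun hf 0
    rw [A.taylorCoeff_one_mul hφ z.2 hφz (hM g), smul_eq_zero] at h1
    obtain ⟨g, rfl⟩ := A.exists_isometry_mul_eq hφ z.2 hφz hM (h1.resolve_left hφ')
    exact hMM g
  by_contra hinf
  refine h _ (isClosed_map_mkL hD hker) (fun hfin => hinf ?_) fun y => ?_
  · refine Module.Finite.of_injective (D.mapQ _ (mkL A z 2).toLinearMap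
      (Submodule.le_comap_map _ D)) ?_
    rw [← LinearMap.ker_eq_bot, Submodule.ker_mapQ, Submodule.comap_map_eq,
      sup_eq_left.2 fun f hf => hker f hf, Submodule.mkQ_map_self]
  · obtain ⟨x, rfl⟩ := Submodule.mkQ_surjective _ y
    obtain ⟨f, rfl⟩ := mkL_surjective x
    obtain ⟨d, hd, _, ⟨g, rfl⟩, rfl⟩ := Submodule.exists_add_eq_of_sup_eq_top hDM f
    refine ⟨mkL A z 1 (deriv φ z • g), ?_⟩
    have e : A.incl z one_le_two (mkL A z 1 (deriv φ z • g)) = mkL A z 2 (M g) := by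
      refine list_injective (funext fun j => ?_)
      rw [list_incl, list_mkL, list_mkL]
      fin_cases j
      · simp [padRight, A.taylorCoeff_one_mul hφ z.2 hφz (hM g)]
      · simp [padRight, hM g z z.2, hφz]
    refine (Submodule.Quotient.eq _).2 ⟨-d, D.neg_mem hd, ?_⟩
    rw [e, map_add]
    change mkL A z 2 (-d) = mkL A z 2 (M g) - (mkL A z 2 d + mkL A z 2 (M g))
    rw [map_neg]
    abel

/-- The converse reduction, in every order: the image of `𝓩⁽ᵏ⁾ → 𝓩⁽ⁿ⁾` comes from functions
vanishing at `z`, and functions divisible by `φⁿ` vanish in `𝓩⁽ⁿ⁾`. -/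
theorem strictlyCosingular_incl_of_finiteDimensional_quotient (A : AdmissibleSpace U W 𝓕) (z : U)
    {φ : ℂ → ℂ} (hφ : IsConformalEquivDisc U φ) (hφz : φ z = 0) (M : 𝓕 →ₗᵢ[ℂ] 𝓕)
    (hM : ∀ f, ∀ w ∈ U, A.toFun (M f) w = φ w • A.toFun f w) {k n : ℕ} (hkn : k < n)
    (h : ∀ D : Submodule ℂ 𝓕, IsClosed (D : Set 𝓕) → (∀ f, M^[n] f ∈ D) →
      D ⊔ LinearMap.range M.toLinearMap = ⊤ → FiniteDimensional ℂ (𝓕 ⧸ D)) :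
    StrictlyCosingular (A.incl z hkn.le) := by
  intro C hC hinf hsurj
  have hmem : ∀ f, M^[n] f ∈ C.comap (mkL A z n).toLinearMap := fun f => by
    have : mkL A z n (M^[n] f) = 0 :=
      mkL_eq_zero_iff.2 (A.taylorList_iterate_mul hφ.1 z hφz hM n f)
    change mkL A z n (M^[n] f) ∈ C
    rw [this]
    exact C.zero_mem
  have hsup : C.comap (mkL A z n).toLinearMap ⊔ LinearMap.range M.toLinearMap = ⊤ := by
    refine eq_top_iff.2 fun f _ => ?_
    obtain ⟨x, hx⟩ := hsurj (C.mkQ (mkL A z n f))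
    obtain ⟨u, hu⟩ := mkL_surjective (A.incl z hkn.le x)
    -- Since `k < n`, elements of the image of the inclusion have zero constant coefficient.
    have hu0 : A.toFun u z = 0 := by
      have h2 := congrFun (congrArg list hu) ⟨n - 1, by omega⟩
      rw [list_incl, list_mkL] at h2
      have h3 : ¬ n - 1 < k := by omega
      simpa [padRight, h3] using h2
    obtain ⟨g, rfl⟩ := A.exists_isometry_mul_eq hφ z.2 hφz hM hu0
    refine Submodule.mem_sup.2 ⟨f - M g, ?_, M g, ⟨g, rfl⟩, sub_add_cancel _ _⟩
    change mkL A z n (f - M g) ∈ C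
    rw [map_sub, hu]
    exact (Submodule.Quotient.eq C).1 hx.symm
  have hfin := h _ (hC.preimage (mkL A z n).continuous) hmem hsup
  refine hinf (Module.Finite.of_surjective (Submodule.mapQ _ C (mkL A z n).toLinearMap le_rfl)
    fun y => ?_)
  obtain ⟨x, rfl⟩ := C.mkQ_surjective y
  obtain ⟨f, rfl⟩ := mkL_surjective x
  exact ⟨Submodule.Quotient.mk f, rfl⟩

end AdmissibleSpace

theorem mainTheorem4 {U : Set ℂ} {W 𝓕 : Type*}
    [NormedAddCommGroup W] [NormedSpace ℂ W] [CompleteSpace W]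
    [NormedAddCommGroup 𝓕] [NormedSpace ℂ 𝓕] [CompleteSpace 𝓕]
    (A : AdmissibleSpace U W 𝓕) (z : U)
    (h : StrictlyCosingular (A.incl z (n := 1) (m := 2) one_le_two))
    (k n : ℕ) (hk : 1 ≤ k) (hkn : k < n) :
    StrictlyCosingular (A.incl z hkn.le) := by
  obtain ⟨φ₀, hφ₀⟩ := A.exists_conformal
  obtain ⟨φ, hφ, hφz⟩ := hφ₀.exists_map_eq_zero z.2
  obtain ⟨M, hM⟩ := A.exists_isometry_mul hφ
  exact A.strictlyCosingular_incl_of_finiteDimensional_quotient z hφ hφz M hM hkn <|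
    M.finiteDimensional_quotient_of_pow
      (A.finiteDimensional_quotient_of_strictlyCosingular z h hφ hφz M hM) n
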